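/- Let $\mathcal{A}$ be a complex unital algebra, $\varphi:\mathcal{A}\to\mathbb{C}$ a linear functional with $\varphi(1)=1$, $\mathcal{X}$ a complex vector space with a (bilinear) two-sided action of $\mathcal{A}$, and $f:\mathcal{X}\to\mathbb{C}$ a linear functional. Make $\mathcal{A}\times\mathcal{X}$ a unital algebra by $(a,\xi)(b,\eta)=(ab,\,a\eta+\xi b)$, let $\mathcal{C}=\mathbb{C}\times\mathbb{C}$ be the commutative algebra with $(x,t)(y,s)=(xy,\,xs+ty)$, and put $E(a,\xi)=(\varphi(a),f(\xi))\in\mathcal{C}$. The cumulants $\kappa_n:(\mathcal{A}\times\mathcal{X})^n\to\mathcal{C}$, $n\ge 1$, are determined by $$\sum_{\gamma\in NC(n)}\ \prod_{B\in\gamma}\kappa_{|B|}\big((x_1,\dots,x_n)|_B\big)=E(x_1\cdots x_n)\qquad(n\ge 1,\ x_1,\dots,x_n\in\mathcal{A}\times\mathcal{X}),$$ where $NC(n)$ is the set of non-crossing partitions of $\{1,\dots,n\}$ and $(x_1,\dots,x_n)|_B$ is the tuple of the $x_i$ with $i\in B$, in increasing order of $i$. For $x\in\mathcal{A}\times\mathcal{X}$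 let $R_x(z)=\sum_{n\ge1}\kappa_n(x,\dots,x)z^n\in\mathcal{C}[[z]]$. If $x=(a,\xi)$ with $\varphi(a)\ne0$, then the coefficient $E(x)$ of $z$ in $R_x$ is invertible in $\mathcal{C}$, so $R_x$ has an inverse $R_x^{\langle-1\rangle}$ with respect to composition, and the $S$-transform of $x$ is $S_x(z)=\frac1z R_x^{\langle-1\rangle}(z)\in\mathcal{C}[[z]]$. Let $\mathcal{A}_1,\mathcal{A}_2\subset\mathcal{A}$ be unital subalgebras and $\mathcal{X}_1,\mathcal{X}_2\subset\mathcal{X}$ linear subspaces such that each $\mathcal{X}_j$ is invariant under the two-sided action of $\mathcal{A}_j$, and suppose that $(\mathcal{A}_1,\mathcal{X}_1)$, $(\mathcal{A}_2,\mathcal{X}_2)$ are free independent, that is, $\kappa_n\big((b_1,\eta_1),\dots,(b_n,\eta_n)\big)=0$ whenever $b_l\in\mathcal{A}_{i_l}$, $\eta_l\in\mathcal{X}_{i_l}$ $(l=1,\dots,n)$ with $i_1,\dots,i_n\in\{1,2\}$ not all equal. **Theorem.** Let $a_j\in\mathcal{A}_j$ and $\xi_j\in\mathcal{X}_j$ with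 $\varphi(a_j)\neq0$ for $j=1,2$. Then $\varphi(a_1a_2)\ne0$, so that the $S$-transform of $(a_1,\xi_1)(a_2,\xi_2)$ is defined, and $$S_{(a_1,\xi_1)(a_2,\xi_2)}(z)=S_{(a_1,\xi_1)}(z)\,S_{(a_2,\xi_2)}(z).$$ -/

import Mathlib

open scoped MulOpposite

noncomputable section

namespace TypeB

/-! ### Non-crossing partitions -/

/-- A partition of `{1, …, n}` is non-crossing if there are no `i < j < k < l` with `i, k` in one
block and `j, l` in a different block. -/
def IsNonCrossing {n : ℕ} (γ : Finpartition (Finset.univ : Finset (Fin n))) : Prop :=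
  ∀ B ∈ γ.parts, ∀ D ∈ γ.parts, ∀ i ∈ B, ∀ j ∈ D, ∀ k ∈ B, ∀ l ∈ D,
    i < j → j < k → k < l → B = D

open Classical in
/-- The finite set of the non-crossing partitions of `{1, …, n}`. -/
def NC (n : ℕ) : Finset (Finpartition (Finset.univ : Finset (Fin n))) :=
  Finset.univ.filter IsNonCrossing

open Classical in
/-- The non-crossing partitions of `{1, …, n}` other than the one-block partition. -/
def properNC (n : ℕ) : Finset (Finpartition (Finset.univ : Finset (Fin n))) :=
  (NC n).filter fun γ => Finset.univ ∉ γ.parts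

theorem card_lt_of_mem_properNC {n : ℕ} {γ : Finpartition (Finset.univ : Finset (Fin n))}
    (hγ : γ ∈ properNC n) {B : Finset (Fin n)} (hB : B ∈ γ.parts) : B.card < n := by
  classical
  have h1 : Finset.univ ∉ γ.parts := (Finset.mem_filter.1 hγ).2
  have h2 : B ≠ Finset.univ := fun h => h1 (h ▸ hB)
  have h3 := Finset.card_lt_card ((Finset.ssubset_univ_iff).2 h2)
  simpa using h3

/-! ### Non-commutative probability spaces of type B

`A` is a complex unital algebra and `X` a complex vector space with a two-sided action of `A`, that
is, an `A`-`A`-bimodule with compatible scalars. `TrivSqZeroExt A X` is the vector space `A × X` with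
`(a, ξ) * (b, η) = (a b, a η + ξ b)`, and `DualNumber ℂ = TrivSqZeroExt ℂ ℂ` is the commutative
algebra of the pairs `(x, t)` with `(x, t) * (y, s) = (x y, x s + t y)`. -/

/-- The functionals `φ : A → ℂ` with `φ 1 = 1` and `f : X → ℂ` of a non-commutative probability
space of type B. -/
structure Functionals (A X : Type*) [Ring A] [Algebra ℂ A] [AddCommGroup X] [Module ℂ X] where
  φ : A →ₗ[ℂ] ℂ
  φ_one : φ 1 = 1
  f : X →ₗ[ℂ] ℂ

namespace Functionals

variable {A X : Type*} [Ring A] [Algebra ℂ A] [AddCommGroup X] [Module ℂ X]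
  [Module A X] [Module Aᵐᵒᵖ X] [SMulCommClass A Aᵐᵒᵖ X]

/-- The map `E (a, ξ) = (φ a, f ξ)` with values in the dual numbers. -/
def E (P : Functionals A X) (x : TrivSqZeroExt A X) : DualNumber ℂ :=
  TrivSqZeroExt.inl (P.φ x.fst) + TrivSqZeroExt.inr (P.f x.snd)

/-- The non-crossing cumulants `κ_n` of type B: the moment-cumulant formula
`∑ γ ∈ NC n, ∏ B ∈ γ, κ_|B| (x | B) = E (x_1 ⋯ x_n)`, solved for the term of the one-block
partition; see `sum_NC_cumulant` and `eq_cumulant`. -/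
def cumulant (P : Functionals A X) (n : ℕ) (x : Fin n → TrivSqZeroExt A X) : DualNumber ℂ :=
  P.E (List.ofFn x).prod -
    ∑ γ ∈ (properNC n).attach, ∏ B ∈ γ.1.parts.attach,
      cumulant P B.1.card fun i => x (B.1.orderEmbOfFin rfl i)
termination_by n
decreasing_by exact card_lt_of_mem_properNC γ.2 B.2

theorem cumulant_eq (P : Functionals A X) (n : ℕ) (x : Fin n → TrivSqZeroExt A X) :
    P.cumulant n x = P.E (List.ofFn x).prod -
      ∑ γ ∈ properNC n, ∏ B ∈ γ.parts, P.cumulant B.card fun i => x (B.orderEmbOfFin rfl i) := by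
  rw [cumulant]
  congr 1
  rw [← Finset.sum_attach (properNC n)]
  refine Finset.sum_congr rfl fun γ _ => ?_
  exact Finset.prod_attach γ.1.parts
    (fun B => P.cumulant B.card fun i => x (B.orderEmbOfFin rfl i))

end Functionals

theorem sum_NC_eq {M : Type*} [CommRing M] {n : ℕ} (hn : 1 ≤ n)
    (F : (m : ℕ) → (Fin m → Fin n) → M) :
    ∑ γ ∈ NC n, ∏ B ∈ γ.parts, F B.card (B.orderEmbOfFin rfl) =
      F n id + ∑ γ ∈ properNC n, ∏ B ∈ γ.parts, F B.card (B.orderEmbOfFin rfl) := by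
  classical
  have hne : (Finset.univ : Finset (Fin n)) ≠ ⊥ := by
    have : NeZero n := ⟨by omega⟩
    exact Finset.univ_nonempty.ne_empty
  set T := Finpartition.indiscrete hne with hT
  have key : (NC n).filter (fun γ => ¬ Finset.univ ∉ γ.parts) = {T} := by
    ext γ
    simp only [NC, Finset.mem_filter, Finset.mem_univ, true_and, not_not, Finset.mem_singleton]
    constructor
    · rintro ⟨-, h⟩
      ext1
      rw [hT, Finpartition.indiscrete_parts]
      ext B
      rw [Finset.mem_singleton]
      refine ⟨fun hB => ?_, fun hB => hB ▸ h⟩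
      by_contra hne'
      have hd : Disjoint B Finset.univ := γ.disjoint hB h hne'
      exact γ.ne_bot hB (hd.eq_bot_of_le (Finset.subset_univ B))
    · rintro rfl
      refine ⟨?_, by simp [hT]⟩
      intro B hB D hD
      simp only [hT, Finpartition.indiscrete_parts, Finset.mem_singleton] at hB hD
      simp [hB, hD]
  rw [← Finset.sum_filter_not_add_sum_filter (NC n) (fun γ => Finset.univ ∉ γ.parts), key,
    Finset.sum_singleton]
  congr 1
  rw [hT, Finpartition.indiscrete_parts, Finset.prod_singleton]
  have h : ∀ (m : ℕ) (hm : (Finset.univ : Finset (Fin n)).card = m) (e : m = n),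
      F m ((Finset.univ : Finset (Fin n)).orderEmbOfFin hm) = F n id := by
    rintro m hm rfl
    congr 1
    have := Finset.orderEmbOfFin_unique hm (f := id) (fun _ => Finset.mem_univ _) strictMono_id
    exact this.symm
  exact h _ rfl (by simp)

namespace Functionals

variable {A X : Type*} [Ring A] [Algebra ℂ A] [AddCommGroup X] [Module ℂ X]
  [Module A X] [Module Aᵐᵒᵖ X] [SMulCommClass A Aᵐᵒᵖ X]

/-- The moment-cumulant formula. -/
theorem sum_NC_cumulant (P : Functionals A X) {n : ℕ} (hn : 1 ≤ n)
    (x : Fin n → TrivSqZeroExt A X) :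
    ∑ γ ∈ NC n, ∏ B ∈ γ.parts, P.cumulant B.card (fun i => x (B.orderEmbOfFin rfl i)) =
      P.E (List.ofFn x).prod := by
  have h := sum_NC_eq hn fun m u => P.cumulant m fun i => x (u i)
  have h2 := P.cumulant_eq n x
  simp only [id] at h
  rw [h, h2]
  ring

/-- The moment-cumulant formula determines the cumulants. -/
theorem eq_cumulant (P : Functionals A X)
    (κ : (n : ℕ) → (Fin n → TrivSqZeroExt A X) → DualNumber ℂ)
    (h : ∀ n, 1 ≤ n → ∀ x : Fin n → TrivSqZeroExt A X,
      ∑ γ ∈ NC n, ∏ B ∈ γ.parts, κ B.card (fun i => x (B.orderEmbOfFin rfl i)) =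
        P.E (List.ofFn x).prod)
    (n : ℕ) (hn : 1 ≤ n) (x : Fin n → TrivSqZeroExt A X) : κ n x = P.cumulant n x := by
  induction n using Nat.strong_induction_on with
  | _ n ih =>
    have h1 := h n hn x
    have h2 := sum_NC_eq hn fun m u => κ m fun i => x (u i)
    simp only [id] at h2
    rw [P.cumulant_eq n x, ← h1, h2, eq_sub_iff_add_eq]
    congr 1
    refine Finset.sum_congr rfl fun γ hγ => Finset.prod_congr rfl fun B hB => ?_
    exact (ih _ (card_lt_of_mem_properNC hγ hB)
      (Finset.card_pos.2 (γ.nonempty_of_mem_parts hB)) _).symm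

/-- The `R`-transform of `x = (a, ξ)`, the series `∑_{n ≥ 1} κ_n (x, …, x) z ^ n`. -/
def rTransform (P : Functionals A X) (x : TrivSqZeroExt A X) : PowerSeries (DualNumber ℂ) :=
  PowerSeries.mk fun n => if n = 0 then 0 else P.cumulant n fun _ => x

theorem coeff_one_rTransform (P : Functionals A X) (x : TrivSqZeroExt A X) :
    PowerSeries.coeff 1 (P.rTransform x) = P.E x := by
  classical
  have h : properNC 1 = ∅ := by
    ext γ
    simp only [properNC, Finset.mem_filter, Finset.notMem_empty, iff_false, not_and, not_not]
    intro _
    obtain ⟨B, hB, h0⟩ := γ.exists_mem (Finset.mem_univ (0 : Fin 1))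
    have : B = Finset.univ := by
      ext i
      simp [Subsingleton.elim i 0, h0]
    exact this ▸ hB
  rw [rTransform, PowerSeries.coeff_mk, if_neg one_ne_zero, cumulant_eq, h]
  simp

theorem constantCoeff_rTransform (P : Functionals A X) (x : TrivSqZeroExt A X) :
    PowerSeries.constantCoeff (P.rTransform x) = 0 := by
  simp [rTransform, ← PowerSeries.coeff_zero_eq_constantCoeff_apply]

theorem isUnit_coeff_one_rTransform (P : Functionals A X) {x : TrivSqZeroExt A X}
    (hx : P.φ x.fst ≠ 0) : IsUnit (PowerSeries.coeff 1 (P.rTransform x)) := by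
  rw [coeff_one_rTransform, TrivSqZeroExt.isUnit_iff_isUnit_fst]
  simpa [E] using hx

/-- The inverse `R^{⟨-1⟩}` of the `R`-transform with respect to the composition of series. -/
def rInverse (P : Functionals A X) (x : TrivSqZeroExt A X) (hx : P.φ x.fst ≠ 0) :
    PowerSeries (DualNumber ℂ) :=
  (P.rTransform x).substInvOfIsUnit (P.isUnit_coeff_one_rTransform hx)

/-- The `S`-transform `S(z) = (1 / z) R^{⟨-1⟩}(z)` of `x = (a, ξ)` with `φ a ≠ 0`; the division by
`z` shifts the coefficients, as `R^{⟨-1⟩}` has no constant term. -/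
def sTransform (P : Functionals A X) (x : TrivSqZeroExt A X) (hx : P.φ x.fst ≠ 0) :
    PowerSeries (DualNumber ℂ) :=
  PowerSeries.mk fun n => PowerSeries.coeff (n + 1) (P.rInverse x hx)

theorem X_mul_sTransform (P : Functionals A X) (x : TrivSqZeroExt A X) (hx : P.φ x.fst ≠ 0) :
    PowerSeries.X * P.sTransform x hx = P.rInverse x hx := by
  ext1 n
  cases n with
  | zero => simp [rInverse]
  | succ n => rw [PowerSeries.coeff_succ_X_mul, sTransform, PowerSeries.coeff_mk]

/-- Free independence of a family of pairs `(𝒜 i, 𝒳 i)`, where `𝒜 i` is a unital subalgebra of `A`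
and `𝒳 i` a linear subspace of `X` that is invariant under the two-sided action of `𝒜 i`: the mixed
cumulants vanish. -/
structure FreeIndependent {ι : Type*} (P : Functionals A X) (𝒜 : ι → Subalgebra ℂ A)
    (𝒳 : ι → Submodule ℂ X) : Prop where
  smul_mem : ∀ i, ∀ a ∈ 𝒜 i, ∀ ξ ∈ 𝒳 i, a • ξ ∈ 𝒳 i
  op_smul_mem : ∀ i, ∀ a ∈ 𝒜 i, ∀ ξ ∈ 𝒳 i, MulOpposite.op a • ξ ∈ 𝒳 i
  cumulant_eq_zero : ∀ (n : ℕ) (x : Fin n → TrivSqZeroExt A X) (i : Fin n → ι),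
    (∀ l, (x l).fst ∈ 𝒜 (i l) ∧ (x l).snd ∈ 𝒳 (i l)) →
      (∃ s t : Fin n, s < t ∧ i s ≠ i t) → P.cumulant n x = 0

end Functionals

end TypeB

end

/-!
The `S`-transform is multiplicative because of four functional equations between the moment series
of the words `(a b)ⁿ`, `(b a)ⁿ`, `b (a b)ⁿ` and `a (b a)ⁿ`, which come from the block of the first
letter in the moment-cumulant formula; Kreweras complements are not needed.

Let `a`, `b` be the two free elements and let `M`, `M'`, `N`, `N'` be these four series. A
non-crossing partition consists of the block of the first letter and of non-crossing partitions of
the gaps of this block (`ncSumThrough_eq`, which chooses the block one element at a time). As mixed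
cumulants vanish, the first block only sees letters equal to the first one, and the gaps are words
of the same kind (`coeff_mul_subst_eq_ncSum`). This gives
`M = 1 + R_a (z N)` and `z N N' = M' R_a (z N)`, and with the letters exchanged
`M' = 1 + R_b (z N')` and `z N' N = M R_b (z N')`. Hence `M' (M - 1) = M (M' - 1)`, that is,
`M = M'`, and `ψ = M - 1` satisfies `R_a (u) = ψ = R_b (v)` with `u = z N`, `v = z N'` and
`u v = z M ψ` (`IsAlternating.exists_subst_eq`). The same decomposition for the powers of `a b`
gives `R_{ab} (z M) = ψ` (`subst_eq_of_card`).

Inverting `R_a`, `R_b`, `R_{ab}` gives `u = ψ S_a (ψ)`, `v = ψ S_b (ψ)` and `z M = ψ S_{ab} (ψ)`, so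
that `ψ² S_a (ψ) S_b (ψ) = ψ² S_{ab} (ψ)`. The series `ψ` has no constant term and its coefficient
`E (a b) = E a * E b` of `z` is a unit; thus `ψ` can be cancelled and then inverted with respect to
composition (`eq_mul_of_subst_eq`).

The argument is carried out for weights of blocks in an arbitrary commutative ring; the cumulants
enter through `Functionals.wordWeight`.
-/

noncomputable section

namespace TypeB

/-! ### Non-crossing partitions of sets of natural numbers -/

/-- `π` is the set of blocks of a non-crossing partition of the finite set `T` of natural numbers.
Partitions of different sets have the same type, so that they can be united and restricted. -/
structure IsNCPartition (T : Finset ℕ) (π : Finset (Finset ℕ)) : Prop where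
  nonempty : ∀ B ∈ π, B.Nonempty
  subset : ∀ B ∈ π, B ⊆ T
  cover : ∀ i ∈ T, ∃ B ∈ π, i ∈ B
  eq_of_mem : ∀ B ∈ π, ∀ D ∈ π, ∀ i, i ∈ B → i ∈ D → B = D
  nonCrossing : ∀ B ∈ π, ∀ D ∈ π, ∀ i ∈ B, ∀ j ∈ D, ∀ k ∈ B, ∀ l ∈ D,
    i < j → j < k → k < l → B = D

open Classical in
/-- The non-crossing partitions of a finite set of natural numbers, each given by its set of
blocks. -/
def ncPartitions (T : Finset ℕ) : Finset (Finset (Finset ℕ)) :=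
  T.powerset.powerset.filter (IsNCPartition T)

theorem mem_ncPartitions {T : Finset ℕ} {π : Finset (Finset ℕ)} :
    π ∈ ncPartitions T ↔ IsNCPartition T π := by
  classical
  rw [ncPartitions, Finset.mem_filter, and_iff_right_iff_imp, Finset.mem_powerset]
  exact fun h B hB => Finset.mem_powerset.2 (h.subset B hB)

theorem ncPartitions_empty : ncPartitions ∅ = {∅} := by
  ext π
  rw [mem_ncPartitions, Finset.mem_singleton]
  constructor
  · intro h
    refine Finset.eq_empty_of_forall_notMem fun B hB => ?_
    exact (h.nonempty B hB).ne_empty (Finset.subset_empty.1 (h.subset B hB))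
  · rintro rfl
    constructor <;> simp

/-- Relabelling along an increasing map `Fin n → ℕ` carries the non-crossing partitions of
`Fin n` to those of its range. -/
theorem sum_NC_map {M : Type*} [CommRing M] {n : ℕ} (e : Fin n ↪o ℕ) (g : Finset ℕ → M) :
    ∑ γ ∈ NC n, ∏ B ∈ γ.parts, g (B.map e.toEmbedding) =
      ∑ π ∈ ncPartitions (Finset.univ.map e.toEmbedding), ∏ B ∈ π, g B := by
  classical
  refine Finset.sum_bij (fun γ _ => γ.parts.map (Finset.mapEmbedding e.toEmbedding).toEmbedding)
    ?_ ?_ ?_ ?_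
  · intro γ hγ
    have hnc : IsNonCrossing γ := (Finset.mem_filter.1 hγ).2
    rw [mem_ncPartitions]
    constructor
    · simp only [Finset.mem_map, forall_exists_index, and_imp]
      rintro _ B hB rfl
      exact (γ.nonempty_of_mem_parts hB).map
    · simp only [Finset.mem_map, forall_exists_index, and_imp]
      rintro _ B hB rfl
      exact Finset.map_subset_map.2 (Finset.subset_univ _)
    · intro i hi
      obtain ⟨i, -, rfl⟩ := Finset.mem_map.1 hi
      obtain ⟨B, hB, h⟩ := γ.exists_mem (Finset.mem_univ i)
      exact ⟨_, Finset.mem_map_of_mem _ hB, Finset.mem_map_of_mem _ h⟩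
    · intro B hB D hD i hiB hiD
      obtain ⟨B, hBγ, rfl⟩ := Finset.mem_map.1 hB
      obtain ⟨D, hDγ, rfl⟩ := Finset.mem_map.1 hD
      obtain ⟨i, hi, rfl⟩ := Finset.mem_map.1 hiB
      have hi' := (Finset.mem_map' _).1 hiD
      rw [γ.eq_of_mem_parts hBγ hDγ hi hi']
    · intro B hB D hD i hi j hj k hk l hl hij hjk hkl
      obtain ⟨B, hBγ, rfl⟩ := Finset.mem_map.1 hB
      obtain ⟨D, hDγ, rfl⟩ := Finset.mem_map.1 hD
      obtain ⟨i, hiB, rfl⟩ := Finset.mem_map.1 hi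
      obtain ⟨j, hjD, rfl⟩ := Finset.mem_map.1 hj
      obtain ⟨k, hkB, rfl⟩ := Finset.mem_map.1 hk
      obtain ⟨l, hlD, rfl⟩ := Finset.mem_map.1 hl
      rw [hnc B hBγ D hDγ i hiB j hjD k hkB l hlD (e.lt_iff_lt.1 hij) (e.lt_iff_lt.1 hjk)
        (e.lt_iff_lt.1 hkl)]
  · intro γ _ γ' _ h
    exact Finpartition.ext (Finset.map_injective _ h)
  · intro π hπ
    rw [mem_ncPartitions] at hπ
    have key : ∀ B ∈ π, (Finset.univ.filter fun i => e i ∈ B).map e.toEmbedding = B := by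
      intro B hB
      ext i
      simp only [Finset.mem_map, Finset.mem_filter, Finset.mem_univ, true_and]
      constructor
      · rintro ⟨j, hj, rfl⟩
        exact hj
      · intro hi
        obtain ⟨j, -, rfl⟩ := Finset.mem_map.1 (hπ.subset B hB hi)
        exact ⟨j, hi, rfl⟩
    -- The preimages of the blocks of `π` form a partition of `Fin n`.
    let γ : Finpartition (Finset.univ : Finset (Fin n)) :=
      Finpartition.ofExistsUnique (π.image fun B => Finset.univ.filter fun i => e i ∈ B)
        (fun _ _ => Finset.subset_univ _)
        (by
          intro i _
          obtain ⟨B, hB, hi⟩ := hπ.cover (e i) (Finset.mem_map_of_mem _ (Finset.mem_univ i))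
          refine ⟨_, ⟨Finset.mem_image_of_mem _ hB, by simpa using hi⟩, ?_⟩
          rintro _ ⟨h, hi'⟩
          obtain ⟨D, hD, rfl⟩ := Finset.mem_image.1 h
          rw [hπ.eq_of_mem B hB D hD (e i) hi (by simpa using hi')])
        (by
          intro h
          obtain ⟨B, hB, h⟩ := Finset.mem_image.1 h
          have h1 := key B hB
          rw [h, Finset.map_empty] at h1
          exact (hπ.nonempty B hB).ne_empty h1.symm)
    have hγ : γ.parts = π.image fun B => Finset.univ.filter fun i => e i ∈ B := rfl
    refine ⟨γ, Finset.mem_filter.2 ⟨Finset.mem_univ _, ?_⟩, ?_⟩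
    · intro B hB D hD i hi j hj k hk l hl hij hjk hkl
      rw [hγ] at hB hD
      obtain ⟨B, hBπ, rfl⟩ := Finset.mem_image.1 hB
      obtain ⟨D, hDπ, rfl⟩ := Finset.mem_image.1 hD
      simp only [Finset.mem_filter, Finset.mem_univ, true_and] at hi hj hk hl
      rw [hπ.nonCrossing B hBπ D hDπ _ hi _ hj _ hk _ hl (e.lt_iff_lt.2 hij) (e.lt_iff_lt.2 hjk)
        (e.lt_iff_lt.2 hkl)]
    · ext B
      simp only [hγ, Finset.mem_map, Finset.mem_image, exists_exists_and_eq_and]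
      constructor
      · rintro ⟨D, hD, rfl⟩
        exact Set.mem_of_eq_of_mem (key D hD) hD
      · intro hB
        exact ⟨B, hB, key B hB⟩
  · intro γ _
    rw [Finset.prod_map]
    rfl

/-! ### Sums over non-crossing partitions and the block of the first element -/

section Weight

variable {M : Type*} [CommRing M] (g : Finset ℕ → M)

/-- The sum over the non-crossing partitions of `T` of the products of the weights `g` of the
blocks. -/
def ncSum (T : Finset ℕ) : M := ∑ π ∈ ncPartitions T, ∏ B ∈ π, g B

open Classical in
/-- The part of `ncSum g (P ∪ W)` that comes from the partitions with `P` inside one block. -/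
def ncSumThrough (P W : Finset ℕ) : M :=
  ∑ π ∈ (ncPartitions (P ∪ W)).filter (fun π => ∃ B ∈ π, P ⊆ B), ∏ B ∈ π, g B

theorem ncSum_empty : ncSum g ∅ = 1 := by
  simp [ncSum, ncPartitions_empty]

theorem ncSum_insert (y : ℕ) (W : Finset ℕ) : ncSum g (insert y W) = ncSumThrough g {y} W := by
  classical
  rw [ncSum, ncSumThrough, Finset.singleton_union, Finset.filter_true_of_mem]
  intro π hπ
  obtain ⟨B, hB, hy⟩ := (mem_ncPartitions.1 hπ).cover y (Finset.mem_insert_self y W)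
  exact ⟨B, hB, Finset.singleton_subset_iff.2 hy⟩

/-- If the members of `S` are the unions of a family of blocks inside `T₁` from `S₁` and a family
of blocks inside `T₂` from `S₂`, then the weighted sum over `S` is a product. -/
theorem sum_prod_eq_mul {T₁ T₂ : Finset ℕ} (hT : Disjoint T₁ T₂)
    {S S₁ S₂ : Finset (Finset (Finset ℕ))}
    (h₁ : ∀ π ∈ S₁, ∀ B ∈ π, B.Nonempty ∧ B ⊆ T₁) (h₂ : ∀ π ∈ S₂, ∀ B ∈ π, B.Nonempty ∧ B ⊆ T₂)
    (hS : ∀ π₁ ∈ S₁, ∀ π₂ ∈ S₂, π₁ ∪ π₂ ∈ S)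
    (hS₁ : ∀ π ∈ S, π.filter (· ⊆ T₁) ∈ S₁) (hS₂ : ∀ π ∈ S, π.filter (· ⊆ T₂) ∈ S₂)
    (hsat : ∀ π ∈ S, ∀ B ∈ π, B ⊆ T₁ ∨ B ⊆ T₂) :
    ∑ π ∈ S, ∏ B ∈ π, g B = (∑ π ∈ S₁, ∏ B ∈ π, g B) * ∑ π ∈ S₂, ∏ B ∈ π, g B := by
  have hne : ∀ B : Finset ℕ, B.Nonempty → B ⊆ T₁ → B ⊆ T₂ → False := fun B hB h h' =>
    hB.ne_empty (Finset.subset_empty.1 (hT h h'))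
  rw [Finset.sum_mul_sum, ← Finset.sum_product']
  symm
  refine Finset.sum_nbij' (fun q => q.1 ∪ q.2) (fun π => (π.filter (· ⊆ T₁), π.filter (· ⊆ T₂)))
    ?_ ?_ ?_ ?_ ?_
  · rintro ⟨π₁, π₂⟩ h
    rw [Finset.mem_product] at h
    exact hS _ h.1 _ h.2
  · intro π h
    exact Finset.mem_product.2 ⟨hS₁ π h, hS₂ π h⟩
  · rintro ⟨π₁, π₂⟩ h
    rw [Finset.mem_product] at h
    have a := h₁ _ h.1
    have b := h₂ _ h.2
    refine Prod.ext ?_ ?_ <;> ext B <;> simp only [Finset.mem_filter, Finset.mem_union]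
    · exact ⟨fun ⟨h, h'⟩ => h.resolve_right fun hB => hne B (b B hB).1 h' (b B hB).2,
        fun h => ⟨.inl h, (a B h).2⟩⟩
    · exact ⟨fun ⟨h, h'⟩ => h.resolve_left fun hB => hne B (a B hB).1 (a B hB).2 h',
        fun h => ⟨.inr h, (b B h).2⟩⟩
  · intro π h
    ext B
    simp only [Finset.mem_filter, Finset.mem_union]
    have := hsat π h B
    tauto
  · rintro ⟨π₁, π₂⟩ h
    rw [Finset.mem_product] at h
    refine (Finset.prod_union ?_).symm
    rw [Finset.disjoint_left]
    intro B hB hB'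
    exact hne B (h₁ _ h.1 B hB).1 (h₁ _ h.1 B hB).2 (h₂ _ h.2 B hB').2

/-- The restriction of a non-crossing partition to a union of blocks. -/
theorem IsNCPartition.filter {T T' : Finset ℕ} {π : Finset (Finset ℕ)} (h : IsNCPartition T π)
    (hT : T' ⊆ T) (hsat : ∀ B ∈ π, ∀ i ∈ B, i ∈ T' → B ⊆ T') :
    IsNCPartition T' (π.filter (· ⊆ T')) where
  nonempty B hB := h.nonempty B (Finset.mem_filter.1 hB).1
  subset B hB := (Finset.mem_filter.1 hB).2
  cover i hi := by
    obtain ⟨B, hB, hiB⟩ := h.cover i (hT hi)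
    exact ⟨B, Finset.mem_filter.2 ⟨hB, hsat B hB i hiB hi⟩, hiB⟩
  eq_of_mem B hB D hD := h.eq_of_mem B (Finset.mem_filter.1 hB).1 D (Finset.mem_filter.1 hD).1
  nonCrossing B hB D hD :=
    h.nonCrossing B (Finset.mem_filter.1 hB).1 D (Finset.mem_filter.1 hD).1

/-- Non-crossing partitions of two disjoint sets, the first of which has no element of the second
between two of its own, form a non-crossing partition of the union. -/
theorem IsNCPartition.union {T₁ T₂ : Finset ℕ} {π₁ π₂ : Finset (Finset ℕ)}
    (h₁ : IsNCPartition T₁ π₁) (h₂ : IsNCPartition T₂ π₂) (hT : Disjoint T₁ T₂)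
    (hconv : ∀ i ∈ T₁, ∀ j ∈ T₂, ∀ k ∈ T₁, i < j → j < k → False) :
    IsNCPartition (T₁ ∪ T₂) (π₁ ∪ π₂) where
  nonempty B hB := (Finset.mem_union.1 hB).elim (h₁.nonempty B) (h₂.nonempty B)
  subset B hB := (Finset.mem_union.1 hB).elim
    (fun h => (h₁.subset B h).trans Finset.subset_union_left)
    (fun h => (h₂.subset B h).trans Finset.subset_union_right)
  cover i hi := by
    rcases Finset.mem_union.1 hi with hi | hi
    · obtain ⟨B, hB, h⟩ := h₁.cover i hi
      exact ⟨B, Finset.mem_union_left _ hB, h⟩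
    · obtain ⟨B, hB, h⟩ := h₂.cover i hi
      exact ⟨B, Finset.mem_union_right _ hB, h⟩
  eq_of_mem B hB D hD i hi hi' := by
    rw [Finset.disjoint_left] at hT
    rcases Finset.mem_union.1 hB with hB | hB <;> rcases Finset.mem_union.1 hD with hD | hD
    · exact h₁.eq_of_mem B hB D hD i hi hi'
    · exact (hT (h₁.subset B hB hi) (h₂.subset D hD hi')).elim
    · exact (hT (h₁.subset D hD hi') (h₂.subset B hB hi)).elim
    · exact h₂.eq_of_mem B hB D hD i hi hi'
  nonCrossing B hB D hD i hi j hj k hk l hl hij hjk hkl := by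
    rcases Finset.mem_union.1 hB with hB | hB <;> rcases Finset.mem_union.1 hD with hD | hD
    · exact h₁.nonCrossing B hB D hD i hi j hj k hk l hl hij hjk hkl
    · exact (hconv i (h₁.subset B hB hi) j (h₂.subset D hD hj) k (h₁.subset B hB hk) hij hjk).elim
    · exact (hconv j (h₁.subset D hD hj) k (h₂.subset B hB hk) l (h₁.subset D hD hl) hjk hkl).elim
    · exact h₂.nonCrossing B hB D hD i hi j hj k hk l hl hij hjk hkl

/-- The one-block partition. -/
theorem isNCPartition_singleton {T : Finset ℕ} (hT : T.Nonempty) : IsNCPartition T {T} := by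
  constructor <;> simp [hT]

open Classical in
/-- The partitions in which `P` is a full block. -/
theorem sum_filter_mem {P W : Finset ℕ} (hP : P.Nonempty) (hPW : ∀ i ∈ P, ∀ j ∈ W, i < j) :
    ∑ π ∈ (ncPartitions (P ∪ W)).filter (fun π => P ∈ π), ∏ B ∈ π, g B = g P * ncSum g W := by
  have hd : Disjoint P W := Finset.disjoint_left.2 fun i h h' => (hPW i h i h').false
  have hsat : ∀ π ∈ (ncPartitions (P ∪ W)).filter (fun π => P ∈ π), ∀ B ∈ π, B = P ∨ B ⊆ W := by
    intro π hπ B hB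
    rw [Finset.mem_filter, mem_ncPartitions] at hπ
    rw [or_iff_not_imp_left]
    intro hne i hi
    refine (Finset.mem_union.1 (hπ.1.subset B hB hi)).resolve_left fun hiP => hne ?_
    exact hπ.1.eq_of_mem B hB P hπ.2 i hi hiP
  rw [ncSum, sum_prod_eq_mul g hd (S₁ := {{P}}) (S₂ := ncPartitions W)]
  · simp
  · simp [hP]
  · intro π hπ B hB
    rw [mem_ncPartitions] at hπ
    exact ⟨hπ.nonempty B hB, hπ.subset B hB⟩
  · intro π₁ hπ₁ π₂ hπ₂
    rw [Finset.mem_singleton] at hπ₁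
    subst hπ₁
    rw [mem_ncPartitions] at hπ₂
    rw [Finset.mem_filter, mem_ncPartitions]
    refine ⟨(isNCPartition_singleton hP).union hπ₂ hd ?_, by simp⟩
    intro i _ j hj k hk _ hjk
    exact (hjk.trans (hPW k hk j hj)).false
  · intro π hπ
    rw [Finset.mem_singleton]
    ext B
    rw [Finset.mem_filter, Finset.mem_singleton]
    constructor
    · rintro ⟨hB, hBP⟩
      refine (hsat π hπ B hB).resolve_right fun hBW => ?_
      have hne := (mem_ncPartitions.1 (Finset.mem_filter.1 hπ).1).nonempty B hB
      exact hne.ne_empty (Finset.subset_empty.1 (hd hBP hBW))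
    · rintro rfl
      exact ⟨(Finset.mem_filter.1 hπ).2, subset_rfl⟩
  · intro π hπ
    rw [mem_ncPartitions]
    refine (mem_ncPartitions.1 (Finset.mem_filter.1 hπ).1).filter Finset.subset_union_right ?_
    intro B hB i hi hiW
    refine (hsat π hπ B hB).resolve_left ?_
    rintro rfl
    exact Finset.disjoint_left.1 hd hi hiW
  · intro π hπ B hB
    exact (hsat π hπ B hB).imp (fun h => h.subset) id

open Classical in
/-- The partitions in which `y ∈ W` is the successor of `P` in the block containing `P`: the
elements of `W` below `y` form a union of blocks. -/
theorem sum_filter_next {P W : Finset ℕ} (hP : P.Nonempty) (hPW : ∀ i ∈ P, ∀ j ∈ W, i < j)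
    {y : ℕ} (hy : y ∈ W) :
    ∑ π ∈ (ncPartitions (P ∪ W)).filter
        (fun π => ∃ B ∈ π, insert y P ⊆ B ∧ ∀ j ∈ B, j ∈ W → y ≤ j), ∏ B ∈ π, g B =
      ncSum g (W.filter (· < y)) * ncSumThrough g (insert y P) (W.filter (y < ·)) := by
  set T₁ := W.filter (· < y) with hT₁
  set T₂ := insert y P ∪ W.filter (y < ·) with hT₂
  have hU : P ∪ W = T₁ ∪ T₂ := by
    ext i
    simp only [hT₁, hT₂, Finset.mem_union, Finset.mem_filter, Finset.mem_insert]
    rcases lt_trichotomy i y with h | h | h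
    · simp [h, h.ne, h.not_gt, or_comm]
    · simp [h, hy]
    · simp [h, h.ne', h.not_gt]
  have hd : Disjoint T₁ T₂ := by
    rw [Finset.disjoint_left]
    simp only [hT₁, hT₂, Finset.mem_union, Finset.mem_filter, Finset.mem_insert]
    rintro i ⟨hi, hiy⟩ ((h | h) | h)
    · exact hiy.ne h
    · exact (hPW i h i hi).false
    · exact (hiy.trans h.2).false
  have hsat : ∀ π ∈ (ncPartitions (P ∪ W)).filter
      (fun π => ∃ B ∈ π, insert y P ⊆ B ∧ ∀ j ∈ B, j ∈ W → y ≤ j),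
      ∀ D ∈ π, ∀ i ∈ D, i ∈ T₁ → D ⊆ T₁ := by
    intro π hπ D hD i hi hi₁ l hl
    rw [Finset.mem_filter, mem_ncPartitions] at hπ
    obtain ⟨hnc, B, hB, hPB, hmin⟩ := hπ
    obtain ⟨hiW, hiy⟩ := Finset.mem_filter.1 hi₁
    have hBD : B ≠ D := by
      rintro rfl
      exact (hmin i hi hiW).not_gt hiy
    have hl' := hnc.subset D hD hl
    rw [hU] at hl'
    -- A block with `i` between `P` and `y` and an element `l` above `y` crosses the block of `P`.
    refine (Finset.mem_union.1 hl').resolve_right fun hl₂ => hBD ?_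
    rcases Finset.mem_union.1 hl₂ with h | h
    · exact hnc.eq_of_mem B hB D hD l (hPB h) hl
    · obtain ⟨p, hp⟩ := hP
      exact hnc.nonCrossing B hB D hD p (hPB (Finset.mem_insert_of_mem hp)) i hi y
        (hPB (Finset.mem_insert_self y P)) l hl (hPW p hp i hiW) hiy (Finset.mem_filter.1 h).2
  have hsat₂ : ∀ π ∈ (ncPartitions (P ∪ W)).filter
      (fun π => ∃ B ∈ π, insert y P ⊆ B ∧ ∀ j ∈ B, j ∈ W → y ≤ j),
      ∀ D ∈ π, ∀ i ∈ D, i ∈ T₂ → D ⊆ T₂ := by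
    intro π hπ D hD i hi hi₂ l hl
    have hl' := (mem_ncPartitions.1 (Finset.mem_filter.1 hπ).1).subset D hD hl
    rw [hU] at hl'
    refine (Finset.mem_union.1 hl').resolve_left fun hl₁ => ?_
    exact Finset.disjoint_left.1 hd (hsat π hπ D hD l hl hl₁ hi) hi₂
  rw [ncSum, ncSumThrough, sum_prod_eq_mul g hd]
  · intro π hπ B hB
    rw [mem_ncPartitions] at hπ
    exact ⟨hπ.nonempty B hB, hπ.subset B hB⟩
  · intro π hπ B hB
    rw [Finset.mem_filter, mem_ncPartitions] at hπ
    exact ⟨hπ.1.nonempty B hB, hπ.1.subset B hB⟩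
  · intro π₁ hπ₁ π₂ hπ₂
    rw [mem_ncPartitions] at hπ₁
    rw [Finset.mem_filter, mem_ncPartitions] at hπ₂
    rw [Finset.mem_filter, mem_ncPartitions]
    obtain ⟨hnc, B, hB, hPB⟩ := hπ₂
    rw [hU]
    refine ⟨hπ₁.union hnc hd ?_, B, Finset.mem_union_right _ hB, hPB, ?_⟩
    · intro i hi j hj k hk hij hjk
      obtain ⟨hiW, -⟩ := Finset.mem_filter.1 hi
      obtain ⟨-, hky⟩ := Finset.mem_filter.1 hk
      rcases Finset.mem_union.1 hj with h | h
      · rcases Finset.mem_insert.1 h with rfl | h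
        · exact (hky.trans hjk).false
        · exact (hij.trans (hPW j h i hiW)).false
      · exact ((Finset.mem_filter.1 h).2.trans (hjk.trans hky)).false
    · intro j hj hjW
      by_contra hlt
      exact Finset.disjoint_left.1 hd (Finset.mem_filter.2 ⟨hjW, not_le.1 hlt⟩)
        (hnc.subset B hB hj)
  · intro π hπ
    rw [mem_ncPartitions]
    exact (mem_ncPartitions.1 (Finset.mem_filter.1 hπ).1).filter
      (hU ▸ Finset.subset_union_left) (hsat π hπ)
  · intro π hπ
    rw [Finset.mem_filter, mem_ncPartitions]
    refine ⟨(mem_ncPartitions.1 (Finset.mem_filter.1 hπ).1).filter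
      (hU ▸ Finset.subset_union_right) (hsat₂ π hπ), ?_⟩
    obtain ⟨B, hB, hPB, -⟩ := (Finset.mem_filter.1 hπ).2
    refine ⟨B, Finset.mem_filter.2 ⟨hB, ?_⟩, hPB⟩
    exact hsat₂ π hπ B hB y (hPB (Finset.mem_insert_self y P))
      (Finset.mem_union_left _ (Finset.mem_insert_self y P))
  · intro π hπ B hB
    obtain ⟨i, hi⟩ := (mem_ncPartitions.1 (Finset.mem_filter.1 hπ).1).nonempty B hB
    have hi' := (mem_ncPartitions.1 (Finset.mem_filter.1 hπ).1).subset B hB hi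
    rw [hU] at hi'
    exact (Finset.mem_union.1 hi').imp (hsat π hπ B hB i hi) (hsat₂ π hπ B hB i hi)

/-- The first-block decomposition, one element of the block at a time: the block containing `P`
either is `P` or has a least element `y` in `W`. -/
theorem ncSumThrough_eq {P W : Finset ℕ} (hP : P.Nonempty) (hPW : ∀ i ∈ P, ∀ j ∈ W, i < j) :
    ncSumThrough g P W = g P * ncSum g W +
      ∑ y ∈ W, ncSum g (W.filter (· < y)) * ncSumThrough g (insert y P) (W.filter (y < ·)) := by
  classical
  -- The terms on the right are the sums over the parts of a decomposition of the set on the left.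
  rw [← sum_filter_mem g hP hPW, ← Finset.sum_congr rfl fun y hy => sum_filter_next g hP hPW hy,
    ← Finset.sum_biUnion, ← Finset.sum_union, ncSumThrough]
  · refine Finset.sum_congr ?_ fun _ _ => rfl
    ext π
    simp only [Finset.mem_union, Finset.mem_biUnion, Finset.mem_filter]
    constructor
    · rintro ⟨hπ, B, hB, hPB⟩
      by_cases hBP : B = P
      · exact .inl ⟨hπ, hBP ▸ hB⟩
      · right
        -- The least element `y` of `W` in `B`.
        have hne : (B.filter (· ∈ W)).Nonempty := by
          obtain ⟨i, hi, hiP⟩ := Finset.exists_of_ssubset (hPB.ssubset_of_ne (Ne.symm hBP))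
          have := (mem_ncPartitions.1 hπ).subset B hB hi
          exact ⟨i, Finset.mem_filter.2 ⟨hi, (Finset.mem_union.1 this).resolve_left hiP⟩⟩
        obtain ⟨hyB, hyW⟩ := Finset.mem_filter.1 (Finset.min'_mem _ hne)
        refine ⟨_, hyW, hπ, B, hB, Finset.insert_subset hyB hPB, fun j hj hjW => ?_⟩
        exact Finset.min'_le _ _ (Finset.mem_filter.2 ⟨hj, hjW⟩)
    · rintro (⟨hπ, h⟩ | ⟨y, hy, hπ, B, hB, hPB, -⟩)
      · exact ⟨hπ, P, h, subset_rfl⟩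
      · exact ⟨hπ, B, hB, (Finset.subset_insert y P).trans hPB⟩
  · rw [Finset.disjoint_left]
    intro π h h'
    obtain ⟨y, hy, h'⟩ := Finset.mem_biUnion.1 h'
    obtain ⟨hπ, hPπ⟩ := Finset.mem_filter.1 h
    obtain ⟨-, B, hB, hPB, -⟩ := Finset.mem_filter.1 h'
    obtain ⟨p, hp⟩ := hP
    have : P = B := (mem_ncPartitions.1 hπ).eq_of_mem P hPπ B hB p hp
      (hPB (Finset.mem_insert_of_mem hp))
    have hyP : y ∈ P := this ▸ hPB (Finset.mem_insert_self y P)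
    exact (hPW y hyP y hy).false
  · intro y hy y' hy' hne
    rw [Function.onFun, Finset.disjoint_left]
    intro π h h'
    obtain ⟨hπ, B, hB, hPB, hmin⟩ := Finset.mem_filter.1 h
    obtain ⟨-, D, hD, hPD, hmin'⟩ := Finset.mem_filter.1 h'
    obtain ⟨p, hp⟩ := hP
    have : B = D := (mem_ncPartitions.1 hπ).eq_of_mem B hB D hD p
      (hPB (Finset.mem_insert_of_mem hp)) (hPD (Finset.mem_insert_of_mem hp))
    subst this
    exact hne (le_antisymm (hmin y' (hPD (Finset.mem_insert_self y' P)) hy')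
      (hmin' y (hPB (Finset.mem_insert_self y P)) hy))

/-- If `g` vanishes on the sets that meet `L` without being contained in it, then no partition with
such a set inside a block contributes. -/
theorem ncSumThrough_eq_zero {L : ℕ → Prop}
    (h0 : ∀ S : Finset ℕ, (∃ i ∈ S, L i) → (∃ i ∈ S, ¬ L i) → g S = 0)
    (n : ℕ) {P W : Finset ℕ} (hW : W.card = n) (hPW : ∀ i ∈ P, ∀ j ∈ W, i < j)
    (hP : ∃ i ∈ P, L i) (hP' : ∃ i ∈ P, ¬ L i) : ncSumThrough g P W = 0 := by
  induction n using Nat.strong_induction_on generalizing P W with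
  | _ n ih =>
    obtain ⟨i, hi, hLi⟩ := hP
    obtain ⟨j, hj, hLj⟩ := hP'
    rw [ncSumThrough_eq g ⟨i, hi⟩ hPW, h0 P ⟨i, hi, hLi⟩ ⟨j, hj, hLj⟩, zero_mul, zero_add]
    refine Finset.sum_eq_zero fun y hy => ?_
    rw [ih _ ?_ rfl ?_ ⟨i, Finset.mem_insert_of_mem hi, hLi⟩ ⟨j, Finset.mem_insert_of_mem hj, hLj⟩,
      mul_zero]
    · rw [← hW]
      refine Finset.card_lt_card (Finset.filter_ssubset.2 ⟨y, hy, lt_irrefl y⟩)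
    · intro k hk l hl
      obtain ⟨hlW, hyl⟩ := Finset.mem_filter.1 hl
      rcases Finset.mem_insert.1 hk with rfl | hk
      · exact hyl
      · exact hPW k hk l hlW

/-! ### Generating functions of sums over intervals -/

open PowerSeries in
/-- The relation `r_k (u) = c_k + u r_{k+1} (u)` for `r_k = ∑ c_{k+j} z ^ j`. -/
theorem subst_mk_shift (c : ℕ → M) {u : M⟦X⟧} (hu : constantCoeff u = 0) (k : ℕ) :
    (mk fun j => c (k + j)).subst u = C (c k) + u * (mk fun j => c (k + 1 + j)).subst u := by
  have hu' : HasSubst u := HasSubst.of_constantCoeff_zero' hu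
  have h : (mk fun j => c (k + j)) = C (c k) + X * mk fun j => c (k + 1 + j) := by
    ext n
    cases n with
    | zero => simp
    | succ n => simp [coeff_succ_X_mul, add_assoc, add_comm 1 n]
  rw [h, subst_add hu', subst_mul hu', subst_X hu', subst_C]
  rfl

open PowerSeries in
theorem constantCoeff_subst_mk (c : ℕ → M) {u : M⟦X⟧} (hu : constantCoeff u = 0) (k : ℕ) :
    constantCoeff (R := M) ((mk fun j => c (k + j)).subst u) = c k := by
  rw [subst_mk_shift c hu, map_add, map_mul, hu, zero_mul, add_zero, constantCoeff_C]

open PowerSeries in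
/-- The generating function of the sums over the intervals that begin at a position `≡ r` modulo
`d`, when the blocks through such positions have weight `c k` if they consist of `k` such positions,
and weight zero if they contain other positions too. The block of the first position cuts the
interval into gaps with generating function `N`, and a last gap with generating function `H`. -/
theorem coeff_mul_subst_eq_ncSum {d r l : ℕ} (hl : l < d) (c : ℕ → M) (N H : M⟦X⟧)
    (hc : ∀ S : Finset ℕ, (∀ i ∈ S, i % d = r) → g S = c S.card)
    (h0 : ∀ S : Finset ℕ, (∃ i ∈ S, i % d = r) → (∃ i ∈ S, ¬ i % d = r) → g S = 0)
    (hN : ∀ y m, y % d = r → ncSum g (Finset.Ico (y + 1) (y + d + d * m)) = coeff m N)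
    (hH : ∀ y m, y % d = r → ncSum g (Finset.Ico (y + 1) (y + 1 + l + d * m)) = coeff m H)
    {y : ℕ} (hy : y % d = r) (m : ℕ) :
    ncSum g (Finset.Ico y (y + 1 + l + d * m)) =
      coeff m (H * (mk fun j => c (1 + j)).subst (X * N)) := by
  -- `P` is the part of the first block that has been chosen already, `y` its last element.
  have key : ∀ m P y, y ∈ P → (∀ i ∈ P, i ≤ y) → (∀ i ∈ P, i % d = r) →
      ncSumThrough g P (Finset.Ico (y + 1) (y + 1 + l + d * m)) =
        coeff m (H * (mk fun j => c (P.card + j)).subst (X * N)) := by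
    intro m
    induction m using Nat.strong_induction_on with
    | _ m ih =>
    intro P y hyP hPy hPr
    have hyr := hPr y hyP
    have hd : 0 < d := by omega
    set f : ℕ → M := fun y' => ncSum g (Finset.Ico (y + 1) y') *
      ncSumThrough g (insert y' P) (Finset.Ico (y' + 1) (y + 1 + l + d * m)) with hf
    have hlt : ∀ i ∈ P, ∀ j ∈ Finset.Ico (y + 1) (y + 1 + l + d * m), i < j := by
      intro i hi j hj
      have := hPy i hi
      rw [Finset.mem_Ico] at hj
      omega
    have h1 : ncSumThrough g P (Finset.Ico (y + 1) (y + 1 + l + d * m)) =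
        c P.card * coeff m H + ∑ y' ∈ Finset.Ico (y + 1) (y + 1 + l + d * m), f y' := by
      rw [ncSumThrough_eq g ⟨y, hyP⟩ hlt, hc P hPr, hH y m hyr]
      congr 1
      refine Finset.sum_congr rfl fun y' hy' => ?_
      rw [Finset.mem_Ico] at hy'
      rw [hf]
      congr 2 <;> ext i <;> simp only [Finset.mem_filter, Finset.mem_Ico] <;> omega
    -- Only the positions `y + d (i + 1)`, which are `≡ r` modulo `d`, can continue the block.
    have h2 : ∑ i ∈ Finset.range m,
        coeff i N * coeff (m - 1 - i) (H * (mk fun j => c (P.card + 1 + j)).subst (X * N)) =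
        ∑ y' ∈ Finset.Ico (y + 1) (y + 1 + l + d * m), f y' := by
      have hmod : ∀ i, (y + d + d * i) % d = r := by
        intro i
        rw [add_assoc, add_comm d, ← Nat.mul_succ, Nat.add_mul_mod_self_left, hyr]
      refine Finset.sum_of_injOn (fun i => y + d + d * i) ?_ ?_ ?_ ?_
      · intro i _ j _ hij
        exact Nat.eq_of_mul_eq_mul_left hd (Nat.add_left_cancel hij)
      · intro i hi
        have hi' : i + 1 ≤ m := Finset.mem_range.1 hi
        have := Nat.mul_le_mul_left d hi'
        rw [Nat.mul_succ] at this
        simp only [Finset.coe_Ico, Set.mem_Ico]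
        omega
      · intro y' hy' hni
        rw [Finset.mem_Ico] at hy'
        have hne : ¬ y' % d = r := by
          intro hr'
          obtain ⟨k, hk⟩ := (Nat.modEq_iff_dvd' (by omega : y ≤ y')).1 (hyr.trans hr'.symm)
          obtain _ | k := k
          · omega
          refine hni ⟨k, ?_, ?_⟩
          · have : d * (k + 1) < d * (m + 1) := by
              rw [Nat.mul_succ d m]
              omega
            have := Nat.lt_of_mul_lt_mul_left this
            simpa using this
          · rw [Nat.mul_succ] at hk
            simp only
            omega
        rw [hf]
        simp only
        rw [ncSumThrough_eq_zero g (L := fun i => i % d = r) h0 _ rfl, mul_zero]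
        · intro i hi j hj
          rw [Finset.mem_Ico] at hj
          rcases Finset.mem_insert.1 hi with rfl | hi
          · omega
          · have := hPy i hi
            omega
        · exact ⟨y, Finset.mem_insert_of_mem hyP, hyr⟩
        · exact ⟨y', Finset.mem_insert_self y' P, hne⟩
      · intro i hi
        have hi' : i + 1 ≤ m := Finset.mem_range.1 hi
        have hnP : y + d + d * i ∉ P := fun h => by
          have := hPy _ h
          omega
        have hend : y + 1 + l + d * m = (y + d + d * i) + 1 + l + d * (m - 1 - i) := by
          obtain ⟨t, rfl⟩ := Nat.exists_eq_add_of_le hi'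
          have : i + 1 + t - 1 - i = t := by omega
          rw [this]
          ring
        rw [hf]
        simp only
        rw [hN y i hyr, hend, ih (m - 1 - i) (by omega) _ _ (Finset.mem_insert_self _ _),
          Finset.card_insert_of_notMem hnP]
        · intro j hj
          rcases Finset.mem_insert.1 hj with rfl | hj
          · exact le_rfl
          · have := hPy j hj
            omega
        · intro j hj
          rcases Finset.mem_insert.1 hj with rfl | hj
          · exact hmod i
          · exact hPr j hj
    have h3 : H * (mk fun j => c (P.card + j)).subst (X * N) = C (c P.card) * H +
        X * (N * (H * (mk fun j => c (P.card + 1 + j)).subst (X * N))) := by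
      rw [subst_mk_shift c (by simp)]
      ring
    rw [h1, ← h2, h3, map_add, coeff_C_mul]
    congr 1
    cases m with
    | zero => simp
    | succ m =>
      rw [coeff_succ_X_mul, coeff_mul, Finset.Nat.sum_antidiagonal_eq_sum_range_succ_mk]
      rfl
  have h : Finset.Ico y (y + 1 + l + d * m) =
      insert y (Finset.Ico (y + 1) (y + 1 + l + d * m)) := by
    ext i
    simp only [Finset.mem_Ico, Finset.mem_insert]
    omega
  rw [h, ncSum_insert, key m {y} y (by simp) (by simp) (by simpa using hy), Finset.card_singleton]

/-! ### Alternating words -/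

/-- The generating function of the sums over the intervals that begin at `s` and have length
`l + 2 m`. -/
def alternatingSeries (s l : ℕ) : PowerSeries M :=
  PowerSeries.mk fun m => ncSum g (Finset.Ico s (s + (l + 2 * m)))

/-- The properties of the weights that come from the alternating word `a b a b …` in two variables
whose mixed cumulants vanish: the sums over intervals depend only on the length and on the parity of
the first position, a set of positions of the parity `r` has weight `c r k`, where `k` is its number
of elements, and a set with positions of both parities has weight zero. -/
structure IsAlternating (c : ℕ → ℕ → M) : Prop where
  ncSum_congr : ∀ s t n : ℕ, s % 2 = t % 2 →
    ncSum g (Finset.Ico s (s + n)) = ncSum g (Finset.Ico t (t + n))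
  eq_of_parity : ∀ r < 2, ∀ S : Finset ℕ, (∀ i ∈ S, i % 2 = r) → g S = c r S.card
  eq_zero : ∀ (r : ℕ) (S : Finset ℕ), (∃ i ∈ S, i % 2 = r) → (∃ i ∈ S, ¬ i % 2 = r) → g S = 0

namespace IsAlternating

open PowerSeries

variable {g} {c : ℕ → ℕ → M}

theorem alternatingSeries_congr (h : IsAlternating g c) {s t : ℕ} (hst : s % 2 = t % 2) (l : ℕ) :
    alternatingSeries g s l = alternatingSeries g t l := by
  ext1 m
  simp only [alternatingSeries, coeff_mk, h.ncSum_congr s t _ hst]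

/-- The block of the first letter of a subword of the alternating word. -/
theorem ncSum_eq_coeff (h : IsAlternating g c) {r l : ℕ} (hr : r < 2) (hl : l < 2) (m : ℕ) :
    ncSum g (Finset.Ico r (r + 1 + l + 2 * m)) = coeff m (alternatingSeries g (r + 1) l *
      (PowerSeries.mk fun j => c r (1 + j)).subst (X * alternatingSeries g (r + 1) 1)) := by
  refine coeff_mul_subst_eq_ncSum g hl (c r) _ _ (h.eq_of_parity r hr) (h.eq_zero r) ?_ ?_
    (Nat.mod_eq_of_lt hr) m
  · intro y m hy
    rw [h.alternatingSeries_congr (t := y + 1) (by omega), alternatingSeries, coeff_mk]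
    congr 2
    omega
  · intro y m hy
    rw [h.alternatingSeries_congr (t := y + 1) (by omega), alternatingSeries, coeff_mk]
    congr 2
    omega

/-- In a word of even length, all gaps of the first block, the last one included, are words of odd
length that begin with the other letter. -/
theorem alternatingSeries_zero_eq (h : IsAlternating g c) {r : ℕ} (hr : r < 2) :
    alternatingSeries g r 0 = 1 + (X * PowerSeries.mk fun j => c r (1 + j)).subst
      (X * alternatingSeries g (r + 1) 1) := by
  have hs : HasSubst (X * alternatingSeries g (r + 1) 1) := .of_constantCoeff_zero' (by simp)
  rw [subst_mul hs, subst_X hs]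
  ext1 n
  cases n with
  | zero => simp [alternatingSeries, ncSum_empty]
  | succ n =>
    rw [map_add, mul_assoc, coeff_succ_X_mul, ← h.ncSum_eq_coeff hr one_lt_two, alternatingSeries,
      coeff_mk, coeff_one, if_neg n.succ_ne_zero]
    have : r + (0 + 2 * (n + 1)) = r + 1 + 1 + 2 * n := by omega
    rw [this, zero_add]

/-- In a word of odd length, the last gap of the first block has even length, and the other gaps
have odd length. -/
theorem alternatingSeries_one_eq (h : IsAlternating g c) {r : ℕ} (hr : r < 2) :
    X * alternatingSeries g (r + 1) 1 * alternatingSeries g r 1 =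
      alternatingSeries g (r + 1) 0 * (X * PowerSeries.mk fun j => c r (1 + j)).subst
        (X * alternatingSeries g (r + 1) 1) := by
  have hs : HasSubst (X * alternatingSeries g (r + 1) 1) := .of_constantCoeff_zero' (by simp)
  have h1 : alternatingSeries g r 1 = alternatingSeries g (r + 1) 0 *
      (PowerSeries.mk fun j => c r (1 + j)).subst (X * alternatingSeries g (r + 1) 1) := by
    ext1 m
    rw [← h.ncSum_eq_coeff hr two_pos, alternatingSeries, coeff_mk]
    congr 2
    omega
  rw [subst_mul hs, subst_X hs, h1]
  ring

/-- With `M` the series for the words of even length and `ψ = M - 1`, there are `u`, `v` with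
`R₀ (u) = ψ`, `R₁ (v) = ψ` and `u v = z M ψ`: the series `u / z` and `v / z` belong to the words of
odd length that begin with the second and with the first letter. -/
theorem exists_subst_eq (h : IsAlternating g c) : ∃ u v : M⟦X⟧, HasSubst u ∧ HasSubst v ∧
    (X * PowerSeries.mk fun j => c 0 (1 + j)).subst u = alternatingSeries g 0 0 - 1 ∧
    (X * PowerSeries.mk fun j => c 1 (1 + j)).subst v = alternatingSeries g 0 0 - 1 ∧
    u * v = X * alternatingSeries g 0 0 * (alternatingSeries g 0 0 - 1) := by
  have r0 := h.alternatingSeries_zero_eq (r := 0) two_pos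
  have r1 := h.alternatingSeries_zero_eq (r := 1) one_lt_two
  have s0 := h.alternatingSeries_one_eq (r := 0) two_pos
  have s1 := h.alternatingSeries_one_eq (r := 1) one_lt_two
  have c0 : alternatingSeries g (1 + 1) 0 = alternatingSeries g 0 0 :=
    h.alternatingSeries_congr (s := 1 + 1) (t := 0) rfl 0
  have c1 : alternatingSeries g (1 + 1) 1 = alternatingSeries g 0 1 :=
    h.alternatingSeries_congr (s := 1 + 1) (t := 0) rfl 1
  rw [zero_add] at r0 s0
  rw [c1] at r1 s1
  rw [c0] at s1
  have hu : HasSubst (X * alternatingSeries g 1 1) := .of_constantCoeff_zero' (by simp)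
  have hv : HasSubst (X * alternatingSeries g 0 1) := .of_constantCoeff_zero' (by simp)
  rw [eq_comm, ← eq_sub_iff_add_eq'] at r0 r1
  -- `M' (M - 1) = M (M' - 1)`, where `M'` belongs to the words that begin with the second letter.
  have hMM : alternatingSeries g 1 0 = alternatingSeries g 0 0 := by
    rw [r0] at s0
    rw [r1] at s1
    linear_combination s0 - s1
  refine ⟨_, _, hu, hv, r0, hMM ▸ r1, ?_⟩
  rw [r0, hMM] at s0
  linear_combination X * s0

theorem ncSum_two (h : IsAlternating g c) : ncSum g (Finset.Ico 0 2) = c 0 1 * c 1 1 := by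
  have h0 := h.ncSum_eq_coeff (r := 0) (l := 1) two_pos one_lt_two 0
  have h1 := h.ncSum_eq_coeff (r := 1) (l := 0) one_lt_two two_pos 0
  rw [coeff_zero_eq_constantCoeff_apply, map_mul, constantCoeff_subst_mk _ (by simp)] at h0 h1
  have h2 : constantCoeff (alternatingSeries g (0 + 1) 1) = ncSum g (Finset.Ico 1 2) := by
    simp [alternatingSeries, ← coeff_zero_eq_constantCoeff_apply]
  have h3 : constantCoeff (alternatingSeries g (1 + 1) 0) = 1 := by
    simp [alternatingSeries, ← coeff_zero_eq_constantCoeff_apply, ncSum_empty]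
  rw [h2] at h0
  rw [h3, one_mul] at h1
  rw [mul_comm]
  exact h0.trans (congrArg (· * c 0 1) h1)

end IsAlternating

open PowerSeries in
/-- If all weights are given by the numbers of elements of the blocks, then the generating function
`F` of the sums over intervals satisfies `F = 1 + R (z F)`. -/
theorem subst_eq_of_card {c : ℕ → M} {F : M⟦X⟧} (hg : ∀ S, g S = c S.card)
    (hF : ∀ s m, ncSum g (Finset.Ico s (s + m)) = coeff m F) :
    (X * mk fun j => c (1 + j)).subst (X * F) = F - 1 := by
  have hs : HasSubst (X * F) := .of_constantCoeff_zero' (by simp)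
  rw [subst_mul hs, subst_X hs]
  ext1 n
  cases n with
  | zero =>
    have hF0 := hF 0 0
    simp only [add_zero, Finset.Ico_self, ncSum_empty] at hF0
    rw [map_sub, ← hF0]
    simp
  | succ n =>
    have h := coeff_mul_subst_eq_ncSum g (d := 1) (r := 0) (l := 0) one_pos c F F (fun S _ => hg S)
      (fun S _ ⟨i, _, hi⟩ => (hi (Nat.mod_one i)).elim) (fun y m _ => by rw [one_mul, hF])
      (fun y m _ => by rw [one_mul, add_zero, hF]) (Nat.zero_mod 1) n
    rw [map_sub, mul_assoc, coeff_succ_X_mul, ← h, coeff_one, if_neg n.succ_ne_zero, sub_zero,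
      ← hF 0 (n + 1)]
    congr 2
    omega

end Weight

/-! ### Inversion of the relations between the series -/

section Substitution

open PowerSeries

variable {K : Type*} [CommRing K]

/-- Substitution of a series with an inverse with respect to composition is injective. -/
theorem subst_injective_of_isUnit {ψ F G : K⟦X⟧} (h0 : constantCoeff ψ = 0)
    (h1 : IsUnit (coeff 1 ψ)) (h : F.subst ψ = G.subst ψ) : F = G := by
  have hψ : HasSubst ψ := HasSubst.of_constantCoeff_zero' h0
  have h2 := congrArg (subst (ψ.substInvOfIsUnit h1)) h
  rwa [subst_comp_subst_apply hψ (HasSubst.substInvOfIsUnit ψ h1),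
    subst_comp_subst_apply hψ (HasSubst.substInvOfIsUnit ψ h1),
    subst_substInvOfIsUnit_right ψ h0 h1, X_subst, X_subst] at h2

/-- A series with an inverse with respect to composition is `z` times a unit, and so can be
cancelled, even if the coefficients have zero divisors. -/
theorem mul_left_cancel_of_isUnit_coeff_one {ψ F G : K⟦X⟧} (h0 : constantCoeff ψ = 0)
    (h1 : IsUnit (coeff 1 ψ)) (h : ψ * F = ψ * G) : F = G := by
  obtain ⟨V, rfl⟩ := X_dvd_iff.2 h0
  have hV : IsUnit V := by
    rw [isUnit_iff_constantCoeff]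
    simpa [coeff_succ_X_mul] using h1
  rw [mul_assoc, mul_assoc] at h
  exact hV.mul_left_cancel (X_mul_cancel h)

/-- If `z S` is inverse to `R` and `R (u) = ψ`, then `u = ψ S (ψ)`. -/
theorem eq_mul_subst_of_subst_eq {R S u ψ : K⟦X⟧} (hR : constantCoeff R = 0)
    (hS : (X * S).subst R = X) (hu : HasSubst u) (hψ : HasSubst ψ) (h : R.subst u = ψ) :
    u = ψ * S.subst ψ := by
  have hR' : HasSubst R := .of_constantCoeff_zero' hR
  have h1 : ψ * S.subst ψ = (X * S).subst ψ := by
    rw [subst_mul hψ, subst_X hψ]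
  rw [h1, ← h, ← subst_comp_subst_apply hR' hu, hS, subst_X hu]

/-- Inverting the relations `R₀ (u) = R₁ (v) = R (w) = ψ` turns `u v = w ψ` into a relation between
the series `S₀`, `S₁` and `S`. -/
theorem eq_mul_of_subst_eq {R₀ R₁ R S₀ S₁ S u v w ψ : K⟦X⟧}
    (hR₀ : constantCoeff R₀ = 0) (hR₁ : constantCoeff R₁ = 0) (hR : constantCoeff R = 0)
    (hS₀ : (X * S₀).subst R₀ = X) (hS₁ : (X * S₁).subst R₁ = X) (hS : (X * S).subst R = X)
    (hu : HasSubst u) (hv : HasSubst v) (hw : HasSubst w)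
    (hψ0 : constantCoeff ψ = 0) (hψ1 : IsUnit (coeff 1 ψ))
    (h₀ : R₀.subst u = ψ) (h₁ : R₁.subst v = ψ) (h : R.subst w = ψ) (huv : u * v = w * ψ) :
    S = S₀ * S₁ := by
  have hψ : HasSubst ψ := .of_constantCoeff_zero' hψ0
  refine subst_injective_of_isUnit hψ0 hψ1 ?_
  -- `ψ ^ 2 S₀ (ψ) S₁ (ψ) = u v = w ψ = ψ ^ 2 S (ψ)`, where `ψ` can be cancelled.
  refine mul_left_cancel_of_isUnit_coeff_one hψ0 hψ1
    (mul_left_cancel_of_isUnit_coeff_one hψ0 hψ1 ?_)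
  have e₀ := eq_mul_subst_of_subst_eq hR₀ hS₀ hu hψ h₀
  have e₁ := eq_mul_subst_of_subst_eq hR₁ hS₁ hv hψ h₁
  have e := eq_mul_subst_of_subst_eq hR hS hw hψ h
  rw [subst_mul hψ]
  calc ψ * (ψ * S.subst ψ) = w * ψ := by rw [← e, mul_comm]
    _ = ψ * (ψ * (S₀.subst ψ * S₁.subst ψ)) := by
      rw [← huv]
      nth_rw 1 [e₀, e₁]
      rw [mul_mul_mul_comm, mul_assoc]

/-- The multiplicativity of the `S`-transform for systems of weights: `g` belongs to the alternating
word in two letters and `g'` to the constant word whose letter is their product. -/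
theorem eq_mul_of_isAlternating {g g' : Finset ℕ → K} {c : ℕ → ℕ → K} {c' : ℕ → K}
    (hg : IsAlternating g c) (hg' : ∀ S, g' S = c' S.card)
    (hgg' : ∀ s m, ncSum g' (Finset.Ico s (s + m)) = ncSum g (Finset.Ico 0 (2 * m)))
    (hc' : IsUnit (c' 1)) {S₀ S₁ S : K⟦X⟧}
    (hS₀ : (X * S₀).subst (X * mk fun j => c 0 (1 + j)) = X)
    (hS₁ : (X * S₁).subst (X * mk fun j => c 1 (1 + j)) = X)
    (hS : (X * S).subst (X * mk fun j => c' (1 + j)) = X) : S = S₀ * S₁ := by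
  obtain ⟨u, v, hu, hv, h₀, h₁, huv⟩ := hg.exists_subst_eq
  have hF : ∀ s m, ncSum g' (Finset.Ico s (s + m)) = coeff m (alternatingSeries g 0 0) := by
    intro s m
    rw [hgg', alternatingSeries, coeff_mk, zero_add, zero_add]
  have hw := subst_eq_of_card g' hg' hF
  have hs0 : constantCoeff (X * alternatingSeries g 0 0) = 0 := by simp
  have hs : HasSubst (X * alternatingSeries g 0 0) := .of_constantCoeff_zero' hs0
  have hF0 : constantCoeff (alternatingSeries g 0 0) = 1 := by
    have := hF 0 0
    simp only [add_zero, Finset.Ico_self, ncSum_empty, coeff_zero_eq_constantCoeff_apply] at this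
    exact this.symm
  refine eq_mul_of_subst_eq (by simp) (by simp) (by simp) hS₀ hS₁ hS hu hv hs ?_ ?_ h₀ h₁ hw huv
  · rw [map_sub, hF0, map_one, sub_self]
  · have h1 : coeff 1 (alternatingSeries g 0 0 - 1) = c' 1 := by
      rw [← hw, subst_mul hs, subst_X hs, mul_assoc]
      change coeff (0 + 1) _ = _
      rw [coeff_succ_X_mul, coeff_zero_eq_constantCoeff_apply, map_mul, hF0, one_mul,
        constantCoeff_subst_mk c' hs0]
    rwa [h1]

end Substitution

namespace Functionals

variable {A X : Type*} [Ring A] [Algebra ℂ A] [AddCommGroup X] [Module ℂ X]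

/-! ### Cumulants of the letters of a word -/

theorem E_one (P : Functionals A X) : P.E 1 = 1 := by
  simp [E, P.φ_one]

variable [Module A X] [Module Aᵐᵒᵖ X]

/-- For a word `x`, the weight of a finite set of positions is the cumulant of the letters at these
positions. -/
def wordWeight (P : Functionals A X) (x : ℕ → TrivSqZeroExt A X) (S : Finset ℕ) : DualNumber ℂ :=
  P.cumulant S.card fun i => x (S.orderEmbOfFin rfl i)

theorem wordWeight_map (P : Functionals A X) (x : ℕ → TrivSqZeroExt A X) {n : ℕ} (e : Fin n ↪o ℕ)
    (B : Finset (Fin n)) : P.wordWeight x (B.map e.toEmbedding) =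
      P.cumulant B.card fun i => x (e (B.orderEmbOfFin rfl i)) := by
  have h : ∀ (m : ℕ) (hm : (B.map e.toEmbedding).card = m) (hB : B.card = m),
      P.wordWeight x (B.map e.toEmbedding) =
        P.cumulant m fun i => x (e (B.orderEmbOfFin hB i)) := by
    rintro _ rfl hB
    have := Finset.orderEmbOfFin_unique rfl (f := fun i => e (B.orderEmbOfFin hB i))
      (fun i => Finset.mem_map_of_mem _ (Finset.orderEmbOfFin_mem B hB i))
      (e.strictMono.comp (B.orderEmbOfFin hB).strictMono)
    rw [wordWeight, ← this]
  exact h _ (Finset.card_map _) rfl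

theorem wordWeight_const (P : Functionals A X) {x : ℕ → TrivSqZeroExt A X} {a : TrivSqZeroExt A X}
    {S : Finset ℕ} (h : ∀ i ∈ S, x i = a) : P.wordWeight x S = P.cumulant S.card fun _ => a := by
  rw [wordWeight]
  congr 1
  ext1 i
  exact h _ (S.orderEmbOfFin_mem rfl i)

theorem rTransform_eq_X_mul (P : Functionals A X) (a : TrivSqZeroExt A X) :
    P.rTransform a = PowerSeries.X * PowerSeries.mk fun j => P.cumulant (1 + j) fun _ => a := by
  ext1 n
  cases n with
  | zero => simp [rTransform]
  | succ n =>
    rw [rTransform, PowerSeries.coeff_succ_X_mul, PowerSeries.coeff_mk, PowerSeries.coeff_mk,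
      if_neg n.succ_ne_zero, add_comm 1 n]

/-- The infinite word `a b a b …`; its first letter `a` has position `0`. -/
def alternating (a b : TrivSqZeroExt A X) (i : ℕ) : TrivSqZeroExt A X :=
  if i % 2 = 0 then a else b

/-- The mixed cumulants of `a` and `b` vanish; the predicate `p` singles out the arguments equal to
`a`. -/
def MixedCumulantsVanish (P : Functionals A X) (a b : TrivSqZeroExt A X) : Prop :=
  ∀ (n : ℕ) (p : Fin n → Prop) [DecidablePred p], (∃ s, p s) → (∃ t, ¬ p t) →
    (P.cumulant n fun l => if p l then a else b) = 0

theorem MixedCumulantsVanish.wordWeight_eq_zero {P : Functionals A X} {a b : TrivSqZeroExt A X}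
    (h : P.MixedCumulantsVanish a b) (r : ℕ) (S : Finset ℕ)
    (h0 : ∃ i ∈ S, i % 2 = r) (h1 : ∃ i ∈ S, ¬ i % 2 = r) :
    P.wordWeight (alternating a b) S = 0 := by
  have key : ∀ i ∈ S, ∀ j ∈ S, i % 2 = 0 → j % 2 = 1 →
      P.wordWeight (alternating a b) S = 0 := by
    intro i hi j hj hi0 hj1
    rw [← Finset.mem_coe, ← S.range_orderEmbOfFin rfl] at hi hj
    obtain ⟨s, rfl⟩ := hi
    obtain ⟨t, rfl⟩ := hj
    exact h _ (fun l => S.orderEmbOfFin rfl l % 2 = 0) ⟨s, hi0⟩ ⟨t, by omega⟩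
  obtain ⟨i, hi, hir⟩ := h0
  obtain ⟨j, hj, hjr⟩ := h1
  rcases Nat.mod_two_eq_zero_or_one i with h2 | h2
  · exact key i hi j hj h2 (by omega)
  · exact key j hj i hi (by omega) h2

theorem FreeIndependent.mixedCumulantsVanish {P : Functionals A X} {𝒜₁ 𝒜₂ : Subalgebra ℂ A}
    {𝒳₁ 𝒳₂ : Submodule ℂ X} (h : P.FreeIndependent ![𝒜₁, 𝒜₂] ![𝒳₁, 𝒳₂])
    {a b : TrivSqZeroExt A X} (ha : a.fst ∈ 𝒜₁ ∧ a.snd ∈ 𝒳₁) (hb : b.fst ∈ 𝒜₂ ∧ b.snd ∈ 𝒳₂) :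
    P.MixedCumulantsVanish a b := by
  rintro n p _ ⟨s, hs⟩ ⟨t, ht⟩
  refine h.cumulant_eq_zero n _ (fun l => if p l then 0 else 1) ?_ ?_
  · intro l
    by_cases hl : p l
    · simpa [hl] using ha
    · simpa [hl] using hb
  · rcases lt_trichotomy s t with hst | rfl | hst
    · exact ⟨s, t, hst, by simp [hs, ht]⟩
    · exact (ht hs).elim
    · exact ⟨t, s, hst, by simp [hs, ht]⟩

variable [SMulCommClass A Aᵐᵒᵖ X]

/-- The moment-cumulant formula for the part of a word on an interval. -/
theorem ncSum_wordWeight_Ico (P : Functionals A X) (x : ℕ → TrivSqZeroExt A X) (s n : ℕ) :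
    ncSum (P.wordWeight x) (Finset.Ico s (s + n)) =
      P.E (List.ofFn fun i : Fin n => x (s + i)).prod := by
  rcases Nat.eq_zero_or_pos n with rfl | hn
  · simp [ncSum_empty, E_one]
  · let e : Fin n ↪o ℕ := OrderEmbedding.ofStrictMono (fun i => s + i)
      fun i j h => Nat.add_lt_add_left h s
    have he : Finset.univ.map e.toEmbedding = Finset.Ico s (s + n) := by
      ext i
      simp only [Finset.mem_map, Finset.mem_univ, true_and, Finset.mem_Ico]
      constructor
      · rintro ⟨j, rfl⟩
        have := j.2
        change s ≤ s + (j : ℕ) ∧ s + (j : ℕ) < s + n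
        omega
      · rintro ⟨h1, h2⟩
        exact ⟨⟨i - s, by omega⟩, Nat.add_sub_cancel' h1⟩
    rw [ncSum, ← he, ← sum_NC_map e, ← P.sum_NC_cumulant hn fun i => x (s + i)]
    exact Finset.sum_congr rfl fun γ _ => Finset.prod_congr rfl fun B _ => P.wordWeight_map x e B

/-- The products of subwords of `a b a b …` depend only on their length and their first letter. -/
theorem MixedCumulantsVanish.isAlternating {P : Functionals A X} {a b : TrivSqZeroExt A X}
    (h : P.MixedCumulantsVanish a b) : IsAlternating (P.wordWeight (alternating a b))
      fun r n => P.cumulant n fun _ => alternating a b r where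
  ncSum_congr s t n hst := by
    rw [ncSum_wordWeight_Ico, ncSum_wordWeight_Ico]
    congr 3
    ext1 i
    have : (s + i) % 2 = (t + i) % 2 := by omega
    rw [alternating, alternating, this]
  eq_of_parity r hr S hS := by
    refine P.wordWeight_const fun i hi => ?_
    rw [alternating, alternating, hS i hi, Nat.mod_eq_of_lt hr]
  eq_zero := h.wordWeight_eq_zero

theorem ncSum_alternating (P : Functionals A X) (a b : TrivSqZeroExt A X) (m : ℕ) :
    ncSum (P.wordWeight (alternating a b)) (Finset.Ico 0 (2 * m)) = P.E ((a * b) ^ m) := by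
  have h := P.ncSum_wordWeight_Ico (alternating a b) 0 (2 * m)
  rw [zero_add] at h
  rw [h]
  clear h
  congr 1
  induction m with
  | zero => simp
  | succ m ih =>
    have h : ∀ i : ℕ, alternating a b (0 + (i + 1 + 1)) = alternating a b (0 + i) := by
      intro i
      have : (0 + (i + 1 + 1)) % 2 = (0 + i) % 2 := by omega
      rw [alternating, alternating, this]
    -- Splitting off the first two letters leaves the word shifted by `2`, which is the same word.
    change (List.ofFn fun i : Fin (2 * m + 1 + 1) => alternating a b (0 + i)).prod = _
    rw [List.ofFn_succ, List.ofFn_succ, List.prod_cons, List.prod_cons, pow_succ', ← ih, mul_assoc]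
    simp only [Fin.val_succ, h]
    simp [alternating]

theorem ncSum_const (P : Functionals A X) (a : TrivSqZeroExt A X) (s m : ℕ) :
    ncSum (P.wordWeight fun _ => a) (Finset.Ico s (s + m)) = P.E (a ^ m) := by
  simp [ncSum_wordWeight_Ico, List.ofFn_const]

/-! ### Multiplicativity of the `S`-transform -/

theorem cumulant_one (P : Functionals A X) (a : TrivSqZeroExt A X) :
    P.cumulant 1 (fun _ => a) = P.E a := by
  rw [← P.coeff_one_rTransform, rTransform, PowerSeries.coeff_mk, if_neg one_ne_zero]

/-- The series `z S` is the inverse of `R` with respect to composition, with `R` in the form in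
which it comes out of the decomposition of words. -/
theorem X_mul_sTransform_subst (P : Functionals A X) {a : TrivSqZeroExt A X}
    (ha : P.φ a.fst ≠ 0) : (PowerSeries.X * P.sTransform a ha).subst
      (PowerSeries.X * PowerSeries.mk fun j => P.cumulant (1 + j) fun _ => a) =
        (PowerSeries.X : PowerSeries (DualNumber ℂ)) := by
  rw [X_mul_sTransform, ← rTransform_eq_X_mul, rInverse]
  exact PowerSeries.subst_substInvOfIsUnit_left _ (P.constantCoeff_rTransform a) _

/-- The expectation is multiplicative on `a * b`; its first component shows that the `S`-transform
of the product is defined. -/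
theorem MixedCumulantsVanish.E_mul {P : Functionals A X} {a b : TrivSqZeroExt A X}
    (h : P.MixedCumulantsVanish a b) : P.E (a * b) = P.E a * P.E b := by
  rw [← pow_one (a * b), ← ncSum_alternating, ← P.cumulant_one a, ← P.cumulant_one b]
  exact h.isAlternating.ncSum_two

theorem MixedCumulantsVanish.sTransform_mul {P : Functionals A X} {a b : TrivSqZeroExt A X}
    (h : P.MixedCumulantsVanish a b) (ha : P.φ a.fst ≠ 0) (hb : P.φ b.fst ≠ 0)
    (hab : P.φ (a * b).fst ≠ 0) :
    P.sTransform (a * b) hab = P.sTransform a ha * P.sTransform b hb := by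
  refine eq_mul_of_isAlternating h.isAlternating (g' := P.wordWeight fun _ => a * b)
    (c' := fun n => P.cumulant n fun _ => a * b) (fun S => P.wordWeight_const fun _ _ => rfl) ?_ ?_
    (P.X_mul_sTransform_subst ha) (P.X_mul_sTransform_subst hb) (P.X_mul_sTransform_subst hab)
  -- The words of length `2 m` in `a`, `b` and of length `m` in `a * b` have the same product.
  · intro s m
    rw [ncSum_const, ncSum_alternating]
  · rw [cumulant_one, ← coeff_one_rTransform]
    exact P.isUnit_coeff_one_rTransform hab

end Functionals
end TypeB

end

theorem mainTheorem1 {A X : Type*} [Ring A] [Algebra ℂ A] [AddCommGroup X] [Module ℂ X]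
    [Module A X] [Module Aᵐᵒᵖ X] [SMulCommClass A Aᵐᵒᵖ X]
    [IsScalarTower ℂ A X] [IsScalarTower ℂ Aᵐᵒᵖ X]
    (P : TypeB.Functionals A X)
    (𝒜₁ 𝒜₂ : Subalgebra ℂ A) (𝒳₁ 𝒳₂ : Submodule ℂ X)
    (hfree : P.FreeIndependent ![𝒜₁, 𝒜₂] ![𝒳₁, 𝒳₂])
    (x₁ x₂ : TrivSqZeroExt A X)
    (hx₁ : x₁.fst ∈ 𝒜₁ ∧ x₁.snd ∈ 𝒳₁) (hx₂ : x₂.fst ∈ 𝒜₂ ∧ x₂.snd ∈ 𝒳₂)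
    (hφ₁ : P.φ x₁.fst ≠ 0) (hφ₂ : P.φ x₂.fst ≠ 0) :
    ∃ hφ : P.φ (x₁ * x₂).fst ≠ 0,
      P.sTransform (x₁ * x₂) hφ = P.sTransform x₁ hφ₁ * P.sTransform x₂ hφ₂ := by
  have h := hfree.mixedCumulantsVanish hx₁ hx₂
  have hφ : P.φ (x₁ * x₂).fst ≠ 0 := by
    have h1 := congrArg TrivSqZeroExt.fst h.E_mul
    simp only [TypeB.Functionals.E, TrivSqZeroExt.fst_mul, TrivSqZeroExt.fst_add,
      TrivSqZeroExt.fst_inl, TrivSqZeroExt.fst_inr, add_zero] at h1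
    rw [TrivSqZeroExt.fst_mul, h1]
    exact mul_ne_zero hφ₁ hφ₂
  exact ⟨hφ, h.sTransform_mul hφ₁ hφ₂ hφ⟩
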